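/- A Boolean function is a map $f\colon\{0,1\}^n\to\{0,1\}$ of some arity $n\ge 1$. For classes $I,J$ of Boolean functions let $IJ$ be the class of all compositions $f(g_1,\dots,g_n)$ with $f\in I$ of arity $n$ and $g_1,\dots,g_n\in J$ of a common arity. Let $\mathsf{J}$ be the clone of projections and $\mathsf{SM}$ the clone of self-dual monotone functions. A class $K$ is $(\mathsf J,\mathsf{SM})$-stable if $K\,\mathsf J\subseteq K$ (that is, $K$ is closed under taking minors) and $\mathsf{SM}\,K\subseteq K$. Notation. $\Omega$ is the class of all Boolean functions. $\mathsf C$ is the class of constant functions, and $\mathsf C_0$, $\mathsf C_1$ are the classes of constant functions with value $0$, respectively $1$. $\mathsf M$ is the class of monotone functions. $\mathsf S$ is the class of self-dual functions ($f(\mathbf a)=\overline{f(\overline{\mathbf a})}$ for all $\mathbf a$), so $\mathsf{SM}=\mathsf S\cap\mathsf M$. $\mathsf R$ is the class of reflexive functions ($f(\mathbf a)=f(\overline{\mathbf a})$ for all $\mathbf a$). $\mathsf S^-$ and $\mathsf S^+$ are the classes of pointwise minorants, respectively majorants, of self-dual functions. $\mathsf U$ is the class of functions with $\mathbf a\wedge\mathbf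 b\ne\mathbf 0$ whenever $f(\mathbf a)=f(\mathbf b)=1$, and $\mathsf W$ is the class of functions with $\mathbf a\vee\mathbf b\ne\mathbf 1$ whenever $f(\mathbf a)=f(\mathbf b)=0$. For a class $K$, let $\overline K=\{\overline f : f\in K\}$, where $\overline f(\mathbf a)=\overline{f(\mathbf a)}$. For $a,b\in\{0,1\}$ let $K_{a*}=\{f\in K: f(\mathbf 0)=a\}$, $K_{*b}=\{f\in K: f(\mathbf 1)=b\}$ and $K_{ab}=K_{a*}\cap K_{*b}$. For $\rho\in\{=,\ne,\le,\ge\}$ let $K_\rho=\{f\in K: f(\mathbf 0)\mathrel\rho f(\mathbf 1)\}$. Theorem. There are exactly 93 $(\mathsf J,\mathsf{SM})$-stable classes of Boolean functions, and they are the following: - $\Omega$, $\Omega_{\le}$, $\Omega_{\ge}$, $\Omega_{\ne}\cup\Omega_{00}$, $\Omega_{\ne}\cup\Omega_{11}$; - $\Omega_{0*}\cup\mathsf C$, $\Omega_{*0}\cup\mathsf C$, $\Omega_{00}\cup\mathsf C$, $\Omega_{01}\cup\mathsf C$, $\Omega_{01}\cup\mathsf C_0$, $\Omega_{01}\cup\mathsf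 C_1$; - $\Omega_{1*}\cup\mathsf C$, $\Omega_{*1}\cup\mathsf C$, $\Omega_{11}\cup\mathsf C$, $\Omega_{10}\cup\mathsf C$, $\Omega_{10}\cup\mathsf C_1$, $\Omega_{10}\cup\mathsf C_0$; - $\Omega_{\ne}$, $\Omega_{=}$, $\Omega_{0*}$, $\Omega_{1*}$, $\Omega_{*0}$, $\Omega_{*1}$, $\Omega_{00}$, $\Omega_{11}$, $\Omega_{01}$, $\Omega_{10}$; - $\mathsf M$, $\mathsf M_{0*}$, $\mathsf M_{*1}$, $\mathsf M_{01}$, $\overline{\mathsf M}$, $\overline{\mathsf M_{0*}}$, $\overline{\mathsf M_{*1}}$, $\overline{\mathsf M_{01}}$; - $\mathsf S^-$, $\mathsf S^-_{\ne}$, $\mathsf S^-_{0*}$, $\mathsf S^-_{*0}$, $\mathsf S^-_{01}\cup\mathsf C_0$, $\mathsf S^-_{10}\cup\mathsf C_0$, $\mathsf S^-_{01}$, $\mathsf S^-_{10}$, $\mathsf S^-_{00}$; - $\mathsf S^+$, $\mathsf S^+_{\ne}$, $\mathsf S^+_{1*}$, $\mathsf S^+_{*1}$, $\mathsf S^+_{10}\cup\mathsf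 C_1$, $\mathsf S^+_{01}\cup\mathsf C_1$, $\mathsf S^+_{10}$, $\mathsf S^+_{01}$, $\mathsf S^+_{11}$; - $\mathsf S$, $\mathsf S_{01}$, $\overline{\mathsf S_{01}}$, $\mathsf{SM}$, $\overline{\mathsf{SM}}$; - $\mathsf U$, $\mathsf U_{01}\cup\mathsf C_0$, $\mathsf U_{01}$, $\mathsf M\cap\mathsf U$, $\mathsf M_{01}\cap\mathsf U$, $\mathsf U_{00}$; - $\overline{\mathsf U}$, $\overline{\mathsf U_{01}}\cup\mathsf C_1$, $\overline{\mathsf U_{01}}$, $\overline{\mathsf M\cap\mathsf U}$, $\overline{\mathsf M_{01}\cap\mathsf U}$, $\overline{\mathsf U}_{11}$; - $\mathsf W$, $\mathsf W_{01}\cup\mathsf C_1$, $\mathsf W_{01}$, $\mathsf M\cap\mathsf W$, $\mathsf M_{01}\cap\mathsf W$, $\mathsf W_{11}$; - $\overline{\mathsf W}$, $\overline{\mathsf W_{01}}\cup\mathsf C_0$, $\overline{\mathsf W_{01}}$, $\overline{\mathsf M\cap\mathsf W}$, $\overline{\mathsf M_{01}\cap\mathsf W}$, $\overline{\mathsf W}_{00}$;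 - $\mathsf U\cap\overline{\mathsf W}$, $\mathsf W\cap\overline{\mathsf U}$; - $\mathsf R$, $\mathsf R_{00}\cup\mathsf C$, $\mathsf R_{11}\cup\mathsf C$, $\mathsf R_{00}$, $\mathsf R_{11}$, $\mathsf C$, $\mathsf C_0$, $\mathsf C_1$, $\emptyset$. Moreover, a class $K$ is $(\mathsf J,\mathsf{SM})$-stable if and only if it is closed under taking minors and under left composition with the ternary majority operation $\mu$, that is, $\{\mu\}K\subseteq K$. -/

import Mathlib

namespace BoolMinion

/-- A Boolean function: an operation `{0,1}ⁿ → {0,1}` of some arity `n ≥ 1`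
(`0` is `false`, `1` is `true`). -/
abbrev BoolFun : Type := Σ n : ℕ+, ((Fin n → Bool) → Bool)

/-- Composition of function classes: all `f(g₁, …, gₙ)` with `f ∈ I` of arity `n` and
`g₁, …, gₙ ∈ J` of a common arity `m`. -/
def comp (I J : Set BoolFun) : Set BoolFun :=
  {h | ∃ (n m : ℕ+) (f : (Fin n → Bool) → Bool) (g : Fin n → (Fin m → Bool) → Bool),
    (⟨n, f⟩ : BoolFun) ∈ I ∧ (∀ i, (⟨m, g i⟩ : BoolFun) ∈ J) ∧
      h = ⟨m, fun a => f (fun i => g i a)⟩}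

/-- `K` is `(C₁, C₂)`-stable: `K C₁ ⊆ K` and `C₂ K ⊆ K`. -/
def IsStable (C₁ C₂ K : Set BoolFun) : Prop :=
  comp K C₁ ⊆ K ∧ comp C₂ K ⊆ K

/-- `g` is a minor of `f`: `g(a) = f(a ∘ σ)` for some map `σ` of argument indices. -/
def IsMinor (g f : BoolFun) : Prop :=
  ∃ σ : Fin f.1 → Fin g.1, ∀ a, g.2 a = f.2 (a ∘ σ)

/-- `K` is a minion: it contains all minors of its members. -/
def IsMinorClosed (K : Set BoolFun) : Prop :=
  ∀ f ∈ K, ∀ g, IsMinor g f → g ∈ K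

/-- The ternary majority operation. -/
def maj : BoolFun :=
  ⟨3, fun a => (a 0 && a 1) || (a 0 && a 2) || (a 1 && a 2)⟩

/-! ### Negation and properties of Boolean functions -/

/-- The (outer) negation of a Boolean function. -/
def neg (f : BoolFun) : BoolFun := ⟨f.1, fun a => !(f.2 a)⟩

/-- The class of the negations of the members of `K`. -/
def negClass (K : Set BoolFun) : Set BoolFun := neg '' K

/-- The value at the tuple `(0, …, 0)`. -/
def atZero (f : BoolFun) : Bool := f.2 (fun _ => false)

/-- The value at the tuple `(1, …, 1)`. -/
def atOne (f : BoolFun) : Bool := f.2 (fun _ => true)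

/-- `K_{a∗}`: members of `K` with `f(0) = a`. -/
def val0 (a : Bool) (K : Set BoolFun) : Set BoolFun := {f | f ∈ K ∧ atZero f = a}

/-- `K_{∗b}`: members of `K` with `f(1) = b`. -/
def val1 (b : Bool) (K : Set BoolFun) : Set BoolFun := {f | f ∈ K ∧ atOne f = b}

/-- `K_{ab}`: members of `K` with `f(0) = a` and `f(1) = b`. -/
def val (a b : Bool) (K : Set BoolFun) : Set BoolFun := val0 a K ∩ val1 b K

/-- Members of `K` with `f(0) = f(1)`. -/
def valEq (K : Set BoolFun) : Set BoolFun := {f | f ∈ K ∧ atZero f = atOne f}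

/-- Members of `K` with `f(0) ≠ f(1)`. -/
def valNe (K : Set BoolFun) : Set BoolFun := {f | f ∈ K ∧ atZero f ≠ atOne f}

/-- Members of `K` with `f(0) ≤ f(1)`. -/
def valLe (K : Set BoolFun) : Set BoolFun := {f | f ∈ K ∧ atZero f ≤ atOne f}

/-- Members of `K` with `f(0) ≥ f(1)`. -/
def valGe (K : Set BoolFun) : Set BoolFun := {f | f ∈ K ∧ atOne f ≤ atZero f}

/-- The class of all Boolean functions. -/
def Om : Set BoolFun := Set.univ

/-- All projections. -/
def Proj : Set BoolFun := {f | ∃ i : Fin f.1, ∀ a, f.2 a = a i}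

/-- All constant functions. -/
def Con : Set BoolFun := {f | ∃ c : Bool, ∀ a, f.2 a = c}

/-- The constant functions with value `0`. -/
def Con0 : Set BoolFun := val false false Con

/-- The constant functions with value `1`. -/
def Con1 : Set BoolFun := val true true Con

/-- All monotone functions, with respect to the product order on `{0,1}ⁿ`. -/
def Mon : Set BoolFun := {f | Monotone f.2}

/-- All self-dual functions. -/
def Sd : Set BoolFun := {f | ∀ a, f.2 a = !(f.2 aᶜ)}

/-- All self-dual monotone functions. -/
def SM : Set BoolFun := Sd ∩ Mon

/-- All reflexive functions. -/
def Refl : Set BoolFun := {f | ∀ a, f.2 a = f.2 aᶜ}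

/-- All minorants of self-dual functions. -/
def Smin : Set BoolFun :=
  {f | ∃ g : (Fin f.1 → Bool) → Bool, (⟨f.1, g⟩ : BoolFun) ∈ Sd ∧ ∀ a, f.2 a ≤ g a}

/-- All majorants of self-dual functions. -/
def Smaj : Set BoolFun :=
  {f | ∃ g : (Fin f.1 → Bool) → Bool, (⟨f.1, g⟩ : BoolFun) ∈ Sd ∧ ∀ a, g a ≤ f.2 a}

/-- All `1`-separating functions of rank `2`. -/
def U : Set BoolFun :=
  {f | ∀ a b, f.2 a = true → f.2 b = true → a ⊓ b ≠ fun _ => false}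

/-- All `0`-separating functions of rank `2`. -/
def W : Set BoolFun :=
  {f | ∀ a b, f.2 a = false → f.2 b = false → a ⊔ b ≠ fun _ => true}

/-! ### The list of classes -/

/-- The 93 classes of the classification. -/
def stableClasses : List (Set BoolFun) :=
  [ -- all functions, and the classes that omit one pair `(f(0), f(1))`
    Om,
    valLe Om, valGe Om, valNe Om ∪ val false false Om, valNe Om ∪ val true true Om,
    -- restrictions on `f(0)` and `f(1)`, with constants added
    val0 false Om ∪ Con, val1 false Om ∪ Con, val false false Om ∪ Con,
    val false true Om ∪ Con, val false true Om ∪ Con0, val false true Om ∪ Con1,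
    val0 true Om ∪ Con, val1 true Om ∪ Con, val true true Om ∪ Con,
    val true false Om ∪ Con, val true false Om ∪ Con1, val true false Om ∪ Con0,
    -- restrictions on `f(0)` and `f(1)`
    valNe Om, valEq Om,
    val0 false Om, val0 true Om, val1 false Om, val1 true Om,
    val false false Om, val true true Om, val false true Om, val true false Om,
    -- monotone functions and their negations
    Mon, val0 false Mon, val1 true Mon, val false true Mon,
    negClass Mon, negClass (val0 false Mon), negClass (val1 true Mon),
    negClass (val false true Mon),
    -- minorants of self-dual functions
    Smin, valNe Smin, val0 false Smin, val1 false Smin,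
    val false true Smin ∪ Con0, val true false Smin ∪ Con0,
    val false true Smin, val true false Smin, val false false Smin,
    -- majorants of self-dual functions
    Smaj, valNe Smaj, val0 true Smaj, val1 true Smaj,
    val true false Smaj ∪ Con1, val false true Smaj ∪ Con1,
    val true false Smaj, val false true Smaj, val true true Smaj,
    -- self-dual functions
    Sd, val false true Sd, negClass (val false true Sd), SM, negClass SM,
    -- `1`-separating functions of rank 2
    U, val false true U ∪ Con0, val false true U, Mon ∩ U, val false true Mon ∩ U,
    val false false U,
    -- their negations
    negClass U, negClass (val false true U) ∪ Con1, negClass (val false true U),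
    negClass (Mon ∩ U), negClass (val false true Mon ∩ U), val true true (negClass U),
    -- `0`-separating functions of rank 2
    W, val false true W ∪ Con1, val false true W, Mon ∩ W, val false true Mon ∩ W,
    val true true W,
    -- their negations
    negClass W, negClass (val false true W) ∪ Con0, negClass (val false true W),
    negClass (Mon ∩ W), negClass (val false true Mon ∩ W), val false false (negClass W),
    U ∩ negClass W, W ∩ negClass U,
    -- reflexive functions
    Refl, val false false Refl ∪ Con, val true true Refl ∪ Con,
    val false false Refl, val true true Refl,
    -- constant functions, and the empty class
    Con, Con0, Con1, ∅ ]

end BoolMinion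

/-!
A class that is closed under minors and under the majority operation is determined by finitely many
yes/no questions, and the answers are restricted enough that only 93 patterns of answers remain.

For two points `a, b` of `{0,1}ⁿ` the pairs `(a i, b i)` are called the *columns* of `a` and `b`. A
class `K` *realizes* the values `(x, y)` on a set `T` of columns if some member `f` of `K`, of any
arity, has `f a = x` and `f b = y` for points with columns in `T`. If `K` is closed under minors, it
contains an `n`-ary function with given values at two points as soon as it realizes these values on
the set of their columns; if moreover `K` is closed under majority, the Baker–Pixley argument shows
that a function belongs to `K` once it agrees with a member of `K` on every two points
(`mem_of_realizes`). By symmetry only the eight column sets containing `(0, 1)` matter. Hence `K`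
consists of all functions whose *code*, the list of the eight binary relations realized on these
sets, lies below the code of `K` (`eq_classOf_code`). Conversely, for any code `s`, the class
`classOf s` of the functions with code below `s` is stable, because whenever a composition of a
self-dual monotone function with functions `g i` takes the values `(x, y)` at two points, so does
some `g i` (`exists_coord_of_mem_SM`). This gives the characterization by majority.

The relations in a code constrain each other: they grow with the column set, transposing the columns
transposes the relation, one may take `a = b`, and two points can be linked through a third one
obtained from them coordinatewise, such as `aᶜ`, which bounds a relation by a product of two others.
An exhaustive search shows that only the 93 codes of `stableCodes` satisfy these constraints
(`code_mem_stableCodes`).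

Each class in the list is defined by a condition on the code of a single function, for instance
"the pair `(1, 1)` is not realized on points with `a ⊓ b = 0`" for `U`. Comparing these conditions on
the codes of single functions identifies the listed classes, in their order, with the classes
`classOf s` for `s` in `stableCodes` (`forall₂_stableCodes_stableClasses`). Finally, the 93 classes
are distinct, since each code is the union of the codes below it of 22 functions of arity at most
three (`sup_irreducibleCodes`).
-/

namespace BoolMinion

/-! ### Realized pairs of values -/

/-- `K` realizes the values `(x, y)` on the column set `T`: some member of `K`, of any arity, takes
the values `x` and `y` at two points `a` and `b` all of whose columns `(a i, b i)` lie in `T`. -/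
def Realizes (K : Set BoolFun) (T : Finset (Bool × Bool)) (x y : Bool) : Prop :=
  ∃ f ∈ K, ∃ a b : Fin f.1 → Bool, (∀ i, (a i, b i) ∈ T) ∧ f.2 a = x ∧ f.2 b = y

theorem realizes_singleton {f : BoolFun} {T : Finset (Bool × Bool)} {x y : Bool} :
    Realizes {f} T x y ↔
      ∃ a b : Fin f.1 → Bool, (∀ i, (a i, b i) ∈ T) ∧ f.2 a = x ∧ f.2 b = y := by
  simp [Realizes]

theorem Realizes.of_mem {K : Set BoolFun} {f : BoolFun} (hf : f ∈ K) {T : Finset (Bool × Bool)}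
    {x y : Bool} (h : Realizes {f} T x y) : Realizes K T x y :=
  ⟨f, hf, realizes_singleton.1 h⟩

theorem Realizes.mono {K : Set BoolFun} {T T' : Finset (Bool × Bool)} (hT : T ⊆ T') {x y : Bool} :
    Realizes K T x y → Realizes K T' x y := by
  rintro ⟨f, hf, a, b, hab, h⟩
  exact ⟨f, hf, a, b, fun i => hT (hab i), h⟩

theorem realizes_swap {K : Set BoolFun} {T : Finset (Bool × Bool)} {x y : Bool} :
    Realizes K (T.image Prod.swap) x y ↔ Realizes K T y x := by
  constructor <;> rintro ⟨f, hf, a, b, hab, hx, hy⟩ <;> refine ⟨f, hf, b, a, fun i => ?_, hy, hx⟩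
  · have := hab i
    simp only [Finset.mem_image, Prod.exists, Prod.swap_prod_mk, Prod.mk.injEq] at this
    obtain ⟨u, v, h, rfl, rfl⟩ := this
    exact h
  · exact Finset.mem_image.2 ⟨_, hab i, rfl⟩

theorem Realizes.diag_left {K : Set BoolFun} {T T' : Finset (Bool × Bool)}
    (hT : ∀ p ∈ T, (p.1, p.1) ∈ T') {x y : Bool} :
    Realizes K T x y → Realizes K T' x x := by
  rintro ⟨f, hf, a, b, hab, hx, -⟩
  exact ⟨f, hf, a, a, fun i => hT _ (hab i), hx, hx⟩

theorem Realizes.diag_right {K : Set BoolFun} {T T' : Finset (Bool × Bool)}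
    (hT : ∀ p ∈ T, (p.2, p.2) ∈ T') {x y : Bool} :
    Realizes K T x y → Realizes K T' y y := by
  rintro ⟨f, hf, a, b, hab, -, hy⟩
  exact ⟨f, hf, b, b, fun i => hT _ (hab i), hy, hy⟩

/-- The value `z` is taken at the third point `fun i => h (a i, b i)`. -/
theorem Realizes.interpolate {K : Set BoolFun} {T T₁ T₂ : Finset (Bool × Bool)}
    (h : Bool × Bool → Bool) (hT : ∀ p ∈ T, (p.1, h p) ∈ T₁ ∧ (h p, p.2) ∈ T₂) {x y : Bool} :
    Realizes K T x y → ∃ z, Realizes K T₁ x z ∧ Realizes K T₂ z y := by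
  rintro ⟨f, hf, a, b, hab, hx, hy⟩
  exact ⟨f.2 fun i => h (a i, b i),
    ⟨f, hf, a, _, fun i => (hT _ (hab i)).1, hx, rfl⟩,
    ⟨f, hf, _, b, fun i => (hT _ (hab i)).2, rfl, hy⟩⟩

/-- The columns allowed for `a = 0` and `b = 1`. -/
abbrev colLt : Finset (Bool × Bool) := {(false, true)}
/-- The columns allowed for `b = aᶜ`. -/
abbrev colCompl : Finset (Bool × Bool) := {(false, true), (true, false)}
/-- The columns allowed for `a = 0` and arbitrary `b`. -/
abbrev colBot : Finset (Bool × Bool) := {(false, false), (false, true)}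
/-- The columns allowed for arbitrary `a` and `b = 1`. -/
abbrev colTop : Finset (Bool × Bool) := {(false, true), (true, true)}
/-- The columns allowed for `a ≤ b`. -/
abbrev colLe : Finset (Bool × Bool) := {(false, false), (false, true), (true, true)}
/-- The columns allowed for `a ⊓ b = 0`. -/
abbrev colDisj : Finset (Bool × Bool) := {(false, false), (false, true), (true, false)}
/-- The columns allowed for `a ⊔ b = 1`. -/
abbrev colCov : Finset (Bool × Bool) := {(false, true), (true, false), (true, true)}
/-- All columns. -/
abbrev colAll : Finset (Bool × Bool) :=
  {(false, false), (false, true), (true, false), (true, true)}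

/-- The sets of columns that contain `(0, 1)`. -/
def columnSets : List (Finset (Bool × Bool)) :=
  [colLt, colCompl, colBot, colTop, colLe, colDisj, colCov, colAll]

/-! ### Stable classes are determined by the realized pairs -/

/-- Identifying and permuting arguments turns a realization on columns that occur in `(a, b)` into a
member of `K` with the same values at `a` and `b` themselves. -/
theorem IsMinorClosed.realizes {K : Set BoolFun} (hK : IsMinorClosed K) {n : ℕ+}
    {T : Finset (Bool × Bool)} {x y : Bool} (h : Realizes K T x y) {a b : Fin n → Bool}
    (hT : ∀ p ∈ T, ∃ i, (a i, b i) = p) :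
    ∃ g : (Fin n → Bool) → Bool, (⟨n, g⟩ : BoolFun) ∈ K ∧ g a = x ∧ g b = y := by
  obtain ⟨f, hf, a', b', hab, hx, hy⟩ := h
  choose σ hσ using fun j => hT _ (hab j)
  have ha : a ∘ σ = a' := funext fun j => congrArg Prod.fst (hσ j)
  have hb : b ∘ σ = b' := funext fun j => congrArg Prod.snd (hσ j)
  exact ⟨fun c => f.2 (c ∘ σ), hK f hf _ ⟨σ, fun _ => rfl⟩, by simp [ha, hx], by simp [hb, hy]⟩

theorem exists_columnSet {n : ℕ+} {a b : Fin n → Bool} (h : ∃ i, a i = false ∧ b i = true) :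
    ∃ T ∈ columnSets, (∀ p ∈ T, ∃ i, (a i, b i) = p) ∧ ∀ i, (a i, b i) ∈ T := by
  classical
  let R : Finset (Bool × Bool) := Finset.univ.image fun i => (a i, b i)
  have hR : ∀ R : Finset (Bool × Bool), (false, true) ∈ R → R ∈ columnSets := by decide
  obtain ⟨i, ha, hb⟩ := h
  refine ⟨R, hR R (Finset.mem_image.2 ⟨i, Finset.mem_univ _, by rw [ha, hb]⟩), fun p hp => ?_,
    fun i => Finset.mem_image_of_mem _ (Finset.mem_univ i)⟩
  obtain ⟨j, -, hj⟩ := Finset.mem_image.1 hp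
  exact ⟨j, hj⟩

theorem exists_agree_pair_of_ne {K : Set BoolFun} (hK : IsMinorClosed K) {n : ℕ+}
    {f : (Fin n → Bool) → Bool}
    (hf : ∀ T ∈ columnSets, ∀ x y, Realizes {⟨n, f⟩} T x y → Realizes K T x y)
    {a b : Fin n → Bool} (hab : a ≠ b) :
    ∃ g : (Fin n → Bool) → Bool, (⟨n, g⟩ : BoolFun) ∈ K ∧ g a = f a ∧ g b = f b := by
  have key : ∀ a b : Fin n → Bool, (∃ i, a i = false ∧ b i = true) →
      ∃ g : (Fin n → Bool) → Bool, (⟨n, g⟩ : BoolFun) ∈ K ∧ g a = f a ∧ g b = f b := by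
    intro a b h
    obtain ⟨T, hT, h₁, h₂⟩ := exists_columnSet h
    exact hK.realizes (hf T hT _ _ (realizes_singleton.2 ⟨a, b, h₂, rfl, rfl⟩)) h₁
  obtain ⟨i, hi⟩ := Function.ne_iff.1 hab
  cases ha : a i <;> cases hb : b i
  · simp [ha, hb] at hi
  · exact key a b ⟨i, ha, hb⟩
  · obtain ⟨g, hg, h₁, h₂⟩ := key b a ⟨i, hb, ha⟩
    exact ⟨g, hg, h₂, h₁⟩
  · simp [ha, hb] at hi

theorem exists_agree_pair {K : Set BoolFun} (hK : IsMinorClosed K) {n : ℕ+}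
    {f : (Fin n → Bool) → Bool}
    (hf : ∀ T ∈ columnSets, ∀ x y, Realizes {⟨n, f⟩} T x y → Realizes K T x y)
    (a b : Fin n → Bool) :
    ∃ g : (Fin n → Bool) → Bool, (⟨n, g⟩ : BoolFun) ∈ K ∧ g a = f a ∧ g b = f b := by
  by_cases hab : a = b
  · have hne : a ≠ aᶜ := fun h => by simpa using congrFun h ⟨0, n.pos⟩
    -- the column set of `(a, a)` does not contain `(0, 1)`, so `a` is paired with `aᶜ`
    obtain ⟨g, hg, h, -⟩ := exists_agree_pair_of_ne hK hf hne
    exact ⟨g, hg, h, hab ▸ h⟩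
  · exact exists_agree_pair_of_ne hK hf hab

theorem maj_mem {K : Set BoolFun} (hK : comp {maj} K ⊆ K) {n : ℕ+}
    {g₀ g₁ g₂ : (Fin n → Bool) → Bool} (h₀ : (⟨n, g₀⟩ : BoolFun) ∈ K)
    (h₁ : (⟨n, g₁⟩ : BoolFun) ∈ K) (h₂ : (⟨n, g₂⟩ : BoolFun) ∈ K) :
    (⟨n, fun a => (g₀ a && g₁ a) || (g₀ a && g₂ a) || (g₁ a && g₂ a)⟩ : BoolFun) ∈ K := by
  refine hK ⟨3, n, maj.2, ![g₀, g₁, g₂], rfl, fun i => ?_, rfl⟩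
  change Fin 3 at i
  fin_cases i <;> assumption

/-- The Baker–Pixley argument: three functions that agree with `f` on `S` except at one point each,
the points being different, have a majority that agrees with `f` on all of `S`. -/
theorem exists_agree_finset {K : Set BoolFun} (hmin : IsMinorClosed K) (hmaj : comp {maj} K ⊆ K)
    {n : ℕ+} {f : (Fin n → Bool) → Bool}
    (hf : ∀ T ∈ columnSets, ∀ x y, Realizes {⟨n, f⟩} T x y → Realizes K T x y)
    (S : Finset (Fin n → Bool)) :
    ∃ g : (Fin n → Bool) → Bool, (⟨n, g⟩ : BoolFun) ∈ K ∧ ∀ a ∈ S, g a = f a := by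
  classical
  induction S using Finset.strongInduction with
  | H S ih =>
    by_cases hS : 2 < S.card
    · obtain ⟨u, v, w, hu, hv, hw, huv, huw, hvw⟩ := Finset.two_lt_card_iff.1 hS
      obtain ⟨g₀, hg₀, h₀⟩ := ih _ (Finset.erase_ssubset hu)
      obtain ⟨g₁, hg₁, h₁⟩ := ih _ (Finset.erase_ssubset hv)
      obtain ⟨g₂, hg₂, h₂⟩ := ih _ (Finset.erase_ssubset hw)
      refine ⟨_, maj_mem hmaj hg₀ hg₁ hg₂, fun a ha => ?_⟩
      -- every point of `S` differs from two of `u`, `v`, `w`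
      by_cases hau : a = u
      · subst hau
        rw [h₁ a (Finset.mem_erase.2 ⟨huv, ha⟩), h₂ a (Finset.mem_erase.2 ⟨huw, ha⟩)]
        cases f a <;> simp
      · by_cases hav : a = v
        · subst hav
          rw [h₀ a (Finset.mem_erase.2 ⟨hau, ha⟩), h₂ a (Finset.mem_erase.2 ⟨hvw, ha⟩)]
          cases f a <;> simp
        · rw [h₀ a (Finset.mem_erase.2 ⟨hau, ha⟩), h₁ a (Finset.mem_erase.2 ⟨hav, ha⟩)]
          cases f a <;> simp
    · have hpair : ∃ u v, ∀ a ∈ S, a = u ∨ a = v := by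
        rcases Nat.lt_or_ge S.card 2 with h | h
        · obtain ⟨u, hu⟩ := Finset.card_le_one_iff_subset_singleton.1 (Nat.lt_succ_iff.1 h)
          exact ⟨u, u, fun a ha => .inl (by simpa using hu ha)⟩
        · obtain ⟨u, v, -, rfl⟩ := Finset.card_eq_two.1 (le_antisymm (not_lt.1 hS) h)
          exact ⟨u, v, fun a ha => by simpa using ha⟩
      obtain ⟨u, v, huv⟩ := hpair
      obtain ⟨g, hg, hu, hv⟩ := exists_agree_pair hmin hf u v
      refine ⟨g, hg, fun a ha => ?_⟩
      rcases huv a ha with rfl | rfl <;> assumption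

theorem mem_of_realizes {K : Set BoolFun} (hmin : IsMinorClosed K) (hmaj : comp {maj} K ⊆ K)
    {f : BoolFun} (hf : ∀ T ∈ columnSets, ∀ x y, Realizes {f} T x y → Realizes K T x y) :
    f ∈ K := by
  obtain ⟨n, f⟩ := f
  obtain ⟨g, hg, h⟩ := exists_agree_finset hmin hmaj hf Finset.univ
  obtain rfl : g = f := funext fun a => h a (Finset.mem_univ a)
  exact hg

/-! ### Closure properties -/

theorem IsStable.isMinorClosed {C K : Set BoolFun} (hK : IsStable Proj C K) : IsMinorClosed K := by
  rintro ⟨n, f⟩ hf ⟨m, g⟩ ⟨σ, hσ⟩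
  refine hK.1 ⟨n, m, f, fun i a => a (σ i), hf, fun i => ⟨σ i, fun _ => rfl⟩, ?_⟩
  rw [show g = fun a => f fun i => a (σ i) from funext hσ]

theorem maj_mem_SM : maj ∈ SM := by
  have hdual : ∀ x y z : Bool, ((x && y) || (x && z) || (y && z)) =
      !((!x && !y) || (!x && !z) || (!y && !z)) := by decide
  have hmono : ∀ x y z x' y' z' : Bool, x ≤ x' → y ≤ y' → z ≤ z' →
      ((x && y) || (x && z) || (y && z)) ≤ ((x' && y') || (x' && z') || (y' && z')) := by decide
  exact ⟨fun a => hdual (a 0) (a 1) (a 2), fun a b hab =>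
    hmono (a 0) (a 1) (a 2) (b 0) (b 1) (b 2) (hab 0) (hab 1) (hab 2)⟩

theorem IsStable.comp_maj_subset {C K : Set BoolFun} (hK : IsStable C SM K) : comp {maj} K ⊆ K := by
  rintro _ ⟨n, m, f, g, hf, hg, rfl⟩
  exact hK.2 ⟨n, m, f, g, (Set.mem_singleton_iff.1 hf) ▸ maj_mem_SM, hg, rfl⟩

theorem Realizes.of_comp_Proj {K : Set BoolFun} {h : BoolFun} (hh : h ∈ comp K Proj)
    {T : Finset (Bool × Bool)} {x y : Bool} (hr : Realizes {h} T x y) :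
    ∃ f ∈ K, Realizes {f} T x y := by
  obtain ⟨n, m, f, g, hf, hg, rfl⟩ := hh
  obtain ⟨a, b, hab, hx, hy⟩ := realizes_singleton.1 hr
  choose σ hσ using hg
  refine ⟨_, hf, realizes_singleton.2
    ⟨fun i => g i a, fun i => g i b, fun i => ?_, hx, hy⟩⟩
  have h : (g i a, g i b) = (a (σ i), b (σ i)) := Prod.ext (hσ i a) (hσ i b)
  exact h ▸ hab (σ i)

/-- Self-dual monotone functions preserve every binary relation on `{0,1}`: otherwise `v i` would
be different from `f v` wherever `u i = f u`, which by monotonicity and self-duality propagates to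
the values of `f` at `u` and `v`. -/
theorem exists_coord_of_mem_SM {n : ℕ+} {f : (Fin n → Bool) → Bool} (hf : (⟨n, f⟩ : BoolFun) ∈ SM)
    (u v : Fin n → Bool) : ∃ i, u i = f u ∧ v i = f v := by
  by_contra! hne
  have hd : ∀ a, f a = !(f aᶜ) := hf.1
  have hm : Monotone f := hf.2
  have aux : ∀ a b : Fin n → Bool, (∀ i, a i = true → b i = true) → f a = true → f b = true :=
    fun a b h => hm (fun i => h i)
  have hu := hd u
  have hv := hd v
  -- in the four cases, `uᶜ ≤ v`, `v ≤ u`, `u ≤ v` and `u ≤ vᶜ`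
  cases hx : f u <;> cases hy : f v <;> simp only [hx, hy] at hne hu hv
  · have := aux uᶜ v (fun i => by have := hne i; revert this; simp) (by simpa using hu)
    simp [hy] at this
  · have := aux v u (fun i => by have := hne i; revert this; cases u i <;> simp) hy
    simp [hx] at this
  · have := aux u v (fun i => by have := hne i; revert this; cases u i <;> simp) hx
    simp [hy] at this
  · have := aux u vᶜ (fun i => by have := hne i; revert this; simp) hx
    simp [this] at hv

theorem Realizes.of_comp_SM {K : Set BoolFun} {h : BoolFun} (hh : h ∈ comp SM K)
    {T : Finset (Bool × Bool)} {x y : Bool} (hr : Realizes {h} T x y) :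
    ∃ f ∈ K, Realizes {f} T x y := by
  obtain ⟨n, m, f, g, hf, hg, rfl⟩ := hh
  obtain ⟨a, b, hab, hx, hy⟩ := realizes_singleton.1 hr
  obtain ⟨i, h₁, h₂⟩ := exists_coord_of_mem_SM hf (fun i => g i a) (fun i => g i b)
  exact ⟨_, hg i, realizes_singleton.2 ⟨a, b, hab, h₁.trans hx, h₂.trans hy⟩⟩

/-! ### Codes of classes -/

/-- Binary relations on `{0,1}` are encoded by numbers below `16`, called masks, with the bit `2x + y`
for the pair `(x, y)`: this is the test whether `(x, y)` belongs to the relation. -/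
def bit (m : ℕ) (x y : Bool) : Bool := m.testBit (2 * x.toNat + y.toNat)

/-- The mask of a relation. -/
def maskOf (r : Bool → Bool → Bool) : ℕ :=
  (r false false).toNat + 2 * (r false true).toNat + 4 * (r true false).toNat +
    8 * (r true true).toNat

theorem bit_maskOf (r : Bool → Bool → Bool) (x y : Bool) : bit (maskOf r) x y = r x y := by
  have key : ∀ p q s t : Bool, bit (p.toNat + 2 * q.toNat + 4 * s.toNat + 8 * t.toNat) x y =
      (bif x then bif y then t else s else bif y then q else p) := by
    cases x <;> cases y <;> decide
  rw [maskOf, key]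
  cases x <;> cases y <;> rfl

theorem maskOf_lt (r : Bool → Bool → Bool) : maskOf r < 16 := by
  have key : ∀ p q s t : Bool, p.toNat + 2 * q.toNat + 4 * s.toNat + 8 * t.toNat < 16 := by decide
  exact key _ _ _ _

/-- Inclusion of the relations encoded by two masks. -/
def sub (m m' : ℕ) : Bool := m &&& m' == m

theorem sub_maskOf {r : Bool → Bool → Bool} {m : ℕ} :
    sub (maskOf r) m = true ↔ ∀ x y, r x y = true → bit m x y = true := by
  rw [sub, beq_iff_eq]
  constructor
  · intro h x y hr
    rw [← bit_maskOf r x y, ← h, bit, Nat.testBit_and, Bool.and_eq_true] at hr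
    exact hr.2
  · intro h
    refine Nat.eq_of_testBit_eq fun i => ?_
    rw [Nat.testBit_and]
    rcases Nat.lt_or_ge i 4 with hi | hi
    · obtain ⟨x, y, rfl⟩ : ∃ x y : Bool, i = 2 * x.toNat + y.toNat := by
        revert i; decide
      have := h x y
      rw [← bit_maskOf r x y] at this
      change (bit (maskOf r) x y && bit m x y) = bit (maskOf r) x y
      cases hb : bit (maskOf r) x y
      · rfl
      · rw [this hb]; rfl
    · rw [Nat.testBit_lt_two_pow ((maskOf_lt r).trans_le
        (Nat.pow_le_pow_right (n := 2) two_pos hi)), Bool.false_and]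

/-- The converse relation. -/
def conv (m : ℕ) : ℕ := maskOf fun x y => bit m y x

/-- The relational product. -/
def relComp (m m' : ℕ) : ℕ :=
  maskOf fun x y => (bit m x false && bit m' false y) || (bit m x true && bit m' true y)

/-- The image of a relation under negation of both entries. -/
def negMask (m : ℕ) : ℕ := maskOf fun x y => bit m (!x) (!y)

open Classical in
/-- The mask of the relation of all pairs of values that `K` realizes on `T`. -/
noncomputable def mask (K : Set BoolFun) (T : Finset (Bool × Bool)) : ℕ :=
  maskOf fun x y => decide (Realizes K T x y)

open Classical in
theorem bit_mask {K : Set BoolFun} {T : Finset (Bool × Bool)} {x y : Bool} :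
    bit (mask K T) x y = true ↔ Realizes K T x y := by
  rw [mask, bit_maskOf, decide_eq_true_iff]

open Classical in
theorem sub_mask {K : Set BoolFun} {T : Finset (Bool × Bool)} {m : ℕ} :
    sub (mask K T) m = true ↔ ∀ x y, Realizes K T x y → bit m x y = true := by
  rw [mask, sub_maskOf]; simp only [decide_eq_true_iff]

/-- One mask for each of the eight sets in `columnSets`, in the same order. -/
structure Code where
  lt : ℕ
  compl : ℕ
  bot : ℕ
  top : ℕ
  le : ℕ
  disj : ℕ
  cov : ℕ
  all : ℕ
deriving DecidableEq

/-- The relations realized by `K` on the eight column sets. -/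
noncomputable def code (K : Set BoolFun) : Code :=
  ⟨mask K colLt, mask K colCompl, mask K colBot, mask K colTop, mask K colLe, mask K colDisj,
    mask K colCov, mask K colAll⟩

/-- The componentwise inclusion of codes. -/
def Code.below (s t : Code) : Bool :=
  sub s.lt t.lt && sub s.compl t.compl && sub s.bot t.bot && sub s.top t.top && sub s.le t.le &&
    sub s.disj t.disj && sub s.cov t.cov && sub s.all t.all

/-- The class of all functions that realize only pairs of values permitted by `s`. -/
def classOf (s : Code) : Set BoolFun := {f | (code {f}).below s = true}

theorem mem_classOf_code {K : Set BoolFun} {f : BoolFun} :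
    f ∈ classOf (code K) ↔
      ∀ T ∈ columnSets, ∀ x y, Realizes {f} T x y → Realizes K T x y := by
  simp only [classOf, Set.mem_ofPred_eq, Code.below, code, Bool.and_eq_true, sub_mask, bit_mask,
    columnSets, List.forall_mem_cons, List.not_mem_nil, false_imp_iff, implies_true, and_true,
    and_assoc]

theorem mem_classOf_of_realizes {K : Set BoolFun} {s : Code} (hK : K ⊆ classOf s) {h : BoolFun}
    (hh : ∀ T x y, Realizes {h} T x y → ∃ f ∈ K, Realizes {f} T x y) : h ∈ classOf s := by
  simp only [classOf, Set.subset_def, Set.mem_ofPred_eq, Code.below, code, Bool.and_eq_true,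
    sub_mask] at hK ⊢
  refine ⟨⟨⟨⟨⟨⟨⟨?_, ?_⟩, ?_⟩, ?_⟩, ?_⟩, ?_⟩, ?_⟩, ?_⟩ <;> intro x y hr <;>
    obtain ⟨f, hf, hr⟩ := hh _ _ _ hr
  · exact (hK f hf).1.1.1.1.1.1.1 x y hr
  · exact (hK f hf).1.1.1.1.1.1.2 x y hr
  · exact (hK f hf).1.1.1.1.1.2 x y hr
  · exact (hK f hf).1.1.1.1.2 x y hr
  · exact (hK f hf).1.1.1.2 x y hr
  · exact (hK f hf).1.1.2 x y hr
  · exact (hK f hf).1.2 x y hr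
  · exact (hK f hf).2 x y hr

theorem isStable_classOf (s : Code) : IsStable Proj SM (classOf s) :=
  ⟨fun _ hh => mem_classOf_of_realizes subset_rfl fun _ _ _ hr => hr.of_comp_Proj hh,
    fun _ hh => mem_classOf_of_realizes subset_rfl fun _ _ _ hr => hr.of_comp_SM hh⟩

/-- A class closed under minors and majority is determined by its code. -/
theorem eq_classOf_code {K : Set BoolFun} (hmin : IsMinorClosed K) (hmaj : comp {maj} K ⊆ K) :
    K = classOf (code K) :=
  Set.ext fun _ => ⟨fun hf => mem_classOf_code.2 fun _ _ _ _ hr => hr.of_mem hf,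
    fun hf => mem_of_realizes hmin hmaj (mem_classOf_code.1 hf)⟩

theorem isStable_iff {K : Set BoolFun} :
    IsStable Proj SM K ↔ IsMinorClosed K ∧ comp {maj} K ⊆ K := by
  refine ⟨fun h => ⟨h.isMinorClosed, h.comp_maj_subset⟩, fun h => ?_⟩
  rw [eq_classOf_code h.1 h.2]
  exact isStable_classOf _

/-! ### Constraints on codes -/

open Classical in
theorem mask_swap {K : Set BoolFun} {T : Finset (Bool × Bool)} :
    mask K (T.image Prod.swap) = conv (mask K T) := by
  refine congrArg maskOf (funext₂ fun x y => ?_)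
  rw [Bool.eq_iff_iff, bit_mask, decide_eq_true_iff, realizes_swap]

theorem mask_mono {K : Set BoolFun} {T T' : Finset (Bool × Bool)} (hT : T ⊆ T') :
    sub (mask K T) (mask K T') = true :=
  sub_mask.2 fun _ _ h => bit_mask.2 (h.mono hT)

/-- The pairs `(x, x)` with `x` in the domain of the relation. -/
def diagLeft (m : ℕ) : ℕ := maskOf fun x y => x == y && (bit m x false || bit m x true)

/-- The pairs `(x, x)` with `x` in the range of the relation. -/
def diagRight (m : ℕ) : ℕ := maskOf fun x y => x == y && (bit m false x || bit m true x)

theorem mask_diagLeft {K : Set BoolFun} {T T' : Finset (Bool × Bool)}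
    (hT : ∀ p ∈ T, (p.1, p.1) ∈ T') : sub (diagLeft (mask K T)) (mask K T') = true := by
  refine sub_maskOf.2 fun x y h => bit_mask.2 ?_
  simp only [Bool.and_eq_true, Bool.or_eq_true, beq_iff_eq, bit_mask] at h
  obtain ⟨rfl, h | h⟩ := h <;> exact h.diag_left hT

theorem mask_diagRight {K : Set BoolFun} {T T' : Finset (Bool × Bool)}
    (hT : ∀ p ∈ T, (p.2, p.2) ∈ T') : sub (diagRight (mask K T)) (mask K T') = true := by
  refine sub_maskOf.2 fun x y h => bit_mask.2 ?_
  simp only [Bool.and_eq_true, Bool.or_eq_true, beq_iff_eq, bit_mask] at h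
  obtain ⟨rfl, h | h⟩ := h <;> exact h.diag_right hT

/-- If the third point `fun i => h (a i, b i)` has columns in `T₁` with `a` and in `T₂` with `b`, then
the relation on `T` is contained in the product of those on `T₁` and `T₂`. -/
theorem mask_relComp {K : Set BoolFun} {T T₁ T₂ : Finset (Bool × Bool)} (h : Bool × Bool → Bool)
    (hT : ∀ p ∈ T, (p.1, h p) ∈ T₁ ∧ (h p, p.2) ∈ T₂) :
    sub (mask K T) (relComp (mask K T₁) (mask K T₂)) = true := by
  refine sub_mask.2 fun x y hr => ?_
  obtain ⟨z, h₁, h₂⟩ := hr.interpolate h hT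
  rw [relComp, bit_maskOf]
  cases z <;> simp [bit_mask.2 h₁, bit_mask.2 h₂]

/-- The code whose masks are the last eight hexadecimal digits of `n`. -/
def Code.ofNat (n : ℕ) : Code :=
  ⟨n / 16 ^ 7 % 16, n / 16 ^ 6 % 16, n / 16 ^ 5 % 16, n / 16 ^ 4 % 16, n / 16 ^ 3 % 16,
    n / 16 ^ 2 % 16, n / 16 % 16, n % 16⟩

/-- The codes of the 93 stable classes, in the order of `stableClasses`. -/
def stableCodes : List Code :=
  [0xffffffff, 0xbfffffff, 0xdfffffff, 0x7fffffff, 0xefffffff, 0xbfbfffff, 0xdffdffff,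
    0x9fbdffff, 0xbfbbffff, 0x3f3bffff, 0xafbaffff, 0xdfdfffff, 0xbffbffff, 0x9fdbffff,
    0xdfddffff, 0xcfcdffff, 0x5fd5ffff, 0x6fffffff, 0x9fffffff, 0x3f3fffff, 0xcfcfffff,
    0x5ff5ffff, 0xaffaffff, 0x1f35ffff, 0x8fcaffff, 0x2f3affff, 0x4fc5ffff, 0xbfbbbfff,
    0x3f3bbfff, 0xafbabfff, 0x2f3abfff, 0xdfdddfff, 0xcfcddfff, 0x5fd5dfff, 0x4fc5dfff,
    0x77ffffff, 0x67ffffff, 0x373fffff, 0x57f5ffff, 0x373bffff, 0x57d5ffff, 0x273affff,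
    0x47c5ffff, 0x1735ffff, 0xeeffffff, 0x6effffff, 0xcecfffff, 0xaefaffff, 0xcecdffff,
    0xaebaffff, 0x4ec5ffff, 0x2e3affff, 0x8ecaffff, 0x66ffffff, 0x263affff, 0x46c5ffff,
    0x263ab7ef, 0x46c5de7f, 0x373ff7ff, 0x373bf7ff, 0x273af7ff, 0x373bb7ff, 0x273ab7ff,
    0x1735f7ff, 0xcecffeff, 0xcecdfeff, 0x4ec5feff, 0xcecddeff, 0x4ec5deff, 0x8ecafeff,
    0xaefaffef, 0xaebaffef, 0x2e3affef, 0xaebabfef, 0x2e3abfef, 0x8ecaffef, 0x57f5ff7f,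
    0x57d5ff7f, 0x47c5ff7f, 0x57d5df7f, 0x47c5df7f, 0x1735ff7f, 0x1735f77f, 0x8ecafeef,
    0x99ffffff, 0x99bdffff, 0x99dbffff, 0x1935ffff, 0x89caffff, 0x99999999, 0x11111111,
    0x88888888, 0x00000000].map Code.ofNat

/-- `P` holds for every mask. -/
def allMasks (P : ℕ → Bool) : Bool := (List.range 16).all P

theorem of_allMasks {P : ℕ → Bool} (h : allMasks P = true) {m : ℕ} (hm : m < 16) : P m = true :=
  List.all_eq_true.1 h m (List.mem_range.2 hm)

/-- Implication of Boolean values. The conclusion is evaluated only if the premise holds, which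
prunes the search in `constraint_search`. -/
def imp (p q : Bool) : Bool := bif p then q else true

theorem of_imp {p q : Bool} (h : imp p q = true) (hp : p = true) : q = true := by
  subst hp; exact h

/-- The search over all codes, with each constraint imposed as soon as its masks are chosen. -/
theorem constraint_search : (allMasks fun lt =>
    allMasks fun compl => imp (sub lt compl && sub (conv compl) compl) <|
    allMasks fun bot => imp (sub lt bot && sub (diagLeft lt) bot) <|
    allMasks fun top => imp (sub lt top && sub (diagRight lt) top &&
      sub bot (relComp lt (conv top)) && sub top (relComp (conv bot) lt)) <|
    allMasks fun le => imp (sub bot le && sub top le && sub (diagRight bot) le) <|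
    allMasks fun disj => imp (sub bot disj && sub compl disj && sub (conv disj) disj &&
      sub le (relComp disj compl) && sub disj (relComp compl (conv le))) <|
    allMasks fun cov => imp (sub top cov && sub compl cov && sub (conv cov) cov &&
      sub le (relComp compl cov) && sub cov (relComp compl le)) <|
    allMasks fun all => imp (sub le all && sub disj all && sub cov all && sub (conv all) all &&
      sub all (relComp top (conv top))) <|
    decide (Code.mk lt compl bot top le disj cov all ∈ stableCodes)) = true := by
  decide +kernel

theorem mask_lt (K : Set BoolFun) (T : Finset (Bool × Bool)) : mask K T < 16 := maskOf_lt _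

/-- The third points used for the products are, in order of appearance, `1`, `0`, `bᶜ`, `aᶜ`, `aᶜ`,
`aᶜ` and `1`. -/
theorem code_mem_stableCodes (K : Set BoolFun) : code K ∈ stableCodes := by
  have mono : ∀ {T T'}, T ⊆ T' → sub (mask K T) (mask K T') = true := mask_mono
  have symm : ∀ {T : Finset (Bool × Bool)}, T.image Prod.swap = T →
      sub (conv (mask K T)) (mask K T) = true := fun h => by
    rw [← mask_swap, h]; exact mono subset_rfl
  have h := of_allMasks constraint_search (mask_lt K colLt)
  replace h := of_imp (of_allMasks h (mask_lt K colCompl)) <| by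
    rw [mono (by decide), symm (by decide)]; rfl
  replace h := of_imp (of_allMasks h (mask_lt K colBot)) <| by
    rw [mono (by decide), mask_diagLeft (by decide)]; rfl
  replace h := of_imp (of_allMasks h (mask_lt K colTop)) <| by
    rw [mono (by decide), mask_diagRight (by decide), ← mask_swap, ← mask_swap,
      mask_relComp (fun _ => true) (by decide), mask_relComp (fun _ => false) (by decide)]; rfl
  replace h := of_imp (of_allMasks h (mask_lt K colLe)) <| by
    rw [mono (by decide), mono (by decide), mask_diagRight (by decide)]; rfl
  replace h := of_imp (of_allMasks h (mask_lt K colDisj)) <| by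
    rw [mono (by decide), mono (by decide), symm (by decide), ← mask_swap,
      mask_relComp (fun p => !p.2) (by decide), mask_relComp (fun p => !p.1) (by decide)]; rfl
  replace h := of_imp (of_allMasks h (mask_lt K colCov)) <| by
    rw [mono (by decide), mono (by decide), symm (by decide),
      mask_relComp (fun p => !p.1) (by decide), mask_relComp (fun p => !p.1) (by decide)]; rfl
  replace h := of_imp (of_allMasks h (mask_lt K colAll)) <| by
    rw [mono (by decide), mono (by decide), mono (by decide), symm (by decide), ← mask_swap,
      mask_relComp (fun _ => true) (by decide)]; rfl
  exact of_decide_eq_true h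

/-! ### The listed classes in terms of codes -/

/-- A computable condition on codes that decides membership in `N` from the code of the single
function; it need not be meaningful on codes of larger classes. -/
class Described (N : Set BoolFun) where
  test : Code → Bool
  mem_iff : ∀ f, f ∈ N ↔ test (code {f}) = true

theorem realizes_singleton_colLt {f : BoolFun} {x y : Bool} :
    Realizes {f} colLt x y ↔ atZero f = x ∧ atOne f = y := by
  rw [realizes_singleton]
  constructor
  · rintro ⟨a, b, hab, rfl, rfl⟩
    simp only [Finset.mem_singleton, Prod.mk.injEq] at hab
    rw [funext fun i => (hab i).1, funext fun i => (hab i).2]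
    exact ⟨rfl, rfl⟩
  · rintro ⟨rfl, rfl⟩
    exact ⟨_, _, fun _ => Finset.mem_singleton_self _, rfl, rfl⟩

theorem bit_lt_code {f : BoolFun} {x y : Bool} :
    bit (code {f}).lt x y = (atZero f == x && atOne f == y) := by
  rw [Bool.eq_iff_iff, Bool.and_eq_true, beq_iff_eq, beq_iff_eq]
  exact bit_mask.trans realizes_singleton_colLt

theorem not_bit_mask {f : BoolFun} {T : Finset (Bool × Bool)} {x y : Bool} :
    (!bit (mask {f} T) x y) = true ↔
      ∀ a b : Fin f.1 → Bool, (∀ i, (a i, b i) ∈ T) → ¬(f.2 a = x ∧ f.2 b = y) := by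
  rw [Bool.not_eq_true', ← Bool.not_eq_true, bit_mask, realizes_singleton]
  push Not
  rfl

instance : Described Om := ⟨fun _ => true, fun f => by simp [Om]⟩

instance : Described (∅ : Set BoolFun) := ⟨fun _ => false, fun f => by simp⟩

instance (N N' : Set BoolFun) [D : Described N] [D' : Described N'] : Described (N ∩ N') :=
  ⟨fun s => D.test s && D'.test s, fun f => by
    rw [Set.mem_inter_iff, D.mem_iff, D'.mem_iff, Bool.and_eq_true]⟩

instance (N N' : Set BoolFun) [D : Described N] [D' : Described N'] : Described (N ∪ N') :=
  ⟨fun s => D.test s || D'.test s, fun f => by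
    rw [Set.mem_union, D.mem_iff, D'.mem_iff, Bool.or_eq_true]⟩

instance (a : Bool) (N : Set BoolFun) [D : Described N] : Described (val0 a N) :=
  ⟨fun s => D.test s && (bit s.lt a false || bit s.lt a true), fun f => by
    rw [Bool.and_eq_true, ← D.mem_iff, bit_lt_code, bit_lt_code]
    cases h : atOne f <;> simp [val0]⟩

instance (b : Bool) (N : Set BoolFun) [D : Described N] : Described (val1 b N) :=
  ⟨fun s => D.test s && (bit s.lt false b || bit s.lt true b), fun f => by
    rw [Bool.and_eq_true, ← D.mem_iff, bit_lt_code, bit_lt_code]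
    cases h : atZero f <;> simp [val1]⟩

instance (a b : Bool) (N : Set BoolFun) [Described N] : Described (val a b N) :=
  inferInstanceAs (Described (val0 a N ∩ val1 b N))

instance (N : Set BoolFun) [D : Described N] : Described (valEq N) :=
  ⟨fun s => D.test s && (bit s.lt false false || bit s.lt true true), fun f => by
    rw [Bool.and_eq_true, ← D.mem_iff, bit_lt_code, bit_lt_code]
    cases h : atZero f <;> cases h' : atOne f <;> simp [valEq, h, h']⟩

instance (N : Set BoolFun) [D : Described N] : Described (valNe N) :=
  ⟨fun s => D.test s && (bit s.lt false true || bit s.lt true false), fun f => by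
    rw [Bool.and_eq_true, ← D.mem_iff, bit_lt_code, bit_lt_code]
    cases h : atZero f <;> cases h' : atOne f <;> simp [valNe, h, h']⟩

instance (N : Set BoolFun) [D : Described N] : Described (valLe N) :=
  ⟨fun s => D.test s && !bit s.lt true false, fun f => by
    rw [Bool.and_eq_true, ← D.mem_iff, bit_lt_code]
    cases h : atZero f <;> cases h' : atOne f <;> simp [valLe, h, h']⟩

instance (N : Set BoolFun) [D : Described N] : Described (valGe N) :=
  ⟨fun s => D.test s && !bit s.lt false true, fun f => by
    rw [Bool.and_eq_true, ← D.mem_iff, bit_lt_code]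
    cases h : atZero f <;> cases h' : atOne f <;> simp [valGe, h, h']⟩

theorem neg_involutive : Function.Involutive neg := fun f => by simp [neg]

theorem mem_negClass {f : BoolFun} {N : Set BoolFun} : f ∈ negClass N ↔ neg f ∈ N :=
  ⟨by rintro ⟨g, hg, rfl⟩; rwa [neg_involutive], fun h => ⟨_, h, neg_involutive f⟩⟩

theorem mask_neg {f : BoolFun} {T : Finset (Bool × Bool)} :
    mask {neg f} T = negMask (mask {f} T) := by
  classical
  refine congrArg maskOf (funext₂ fun x y => ?_)
  rw [Bool.eq_iff_iff, bit_mask, decide_eq_true_iff, realizes_singleton, realizes_singleton]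
  simp only [neg, Bool.not_eq_eq_eq_not]

/-- The code of the class of negations. -/
def Code.neg (s : Code) : Code :=
  ⟨negMask s.lt, negMask s.compl, negMask s.bot, negMask s.top, negMask s.le, negMask s.disj,
    negMask s.cov, negMask s.all⟩

instance (N : Set BoolFun) [D : Described N] : Described (negClass N) :=
  ⟨fun s => D.test s.neg, fun f => by
    rw [mem_negClass, D.mem_iff]
    simp only [code, mask_neg, Code.neg]⟩

instance : Described Con := ⟨fun s => !bit s.all false true, fun f => by
  refine Iff.trans ?_ not_bit_mask.symm
  constructor
  · rintro ⟨c, hc⟩ a b - ⟨ha, hb⟩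
    rw [hc] at ha hb
    exact Bool.false_ne_true (ha.symm.trans hb)
  · intro h
    have all : ∀ p : Bool × Bool, p ∈ colAll := by decide
    refine ⟨atZero f, fun a => ?_⟩
    have h₁ := h a (fun _ => false) fun i => all _
    have h₂ := h (fun _ => false) a fun i => all _
    rw [atZero]
    revert h₁ h₂
    cases f.2 a <;> cases f.2 fun _ => false <;> simp⟩

instance : Described Con0 := inferInstanceAs (Described (val false false Con))

instance : Described Con1 := inferInstanceAs (Described (val true true Con))

instance : Described Mon := ⟨fun s => !bit s.le true false, fun f => by
  refine Iff.trans ?_ not_bit_mask.symm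
  have hle : ∀ x y : Bool, (x, y) ∈ colLe ↔ x ≤ y := by decide
  have hv : ∀ x y : Bool, x ≤ y ↔ ¬(x = true ∧ y = false) := by decide
  simp only [hle, ← hv]
  exact Iff.rfl⟩

theorem forall_colCompl_iff {n : ℕ} {a b : Fin n → Bool} :
    (∀ i, (a i, b i) ∈ colCompl) ↔ b = aᶜ := by
  have h : ∀ x y : Bool, (x, y) ∈ colCompl ↔ y = !x := by decide
  simp only [h]
  exact funext_iff.symm

theorem not_bit_compl {f : BoolFun} {x y : Bool} :
    (!bit (code {f}).compl x y) = true ↔ ∀ a, ¬(f.2 a = x ∧ f.2 aᶜ = y) := by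
  refine not_bit_mask.trans ?_
  simp only [forall_colCompl_iff]
  exact ⟨fun h a => h a _ rfl, by rintro h a _ rfl; exact h a⟩

instance : Described Sd :=
  ⟨fun s => !bit s.compl false false && !bit s.compl true true, fun f => by
    rw [Bool.and_eq_true, not_bit_compl, not_bit_compl, ← forall_and]
    refine forall_congr' fun a => ?_
    cases f.2 a <;> cases f.2 aᶜ <;> decide⟩

instance : Described SM := inferInstanceAs (Described (Sd ∩ Mon))

instance : Described Refl := ⟨fun s => !bit s.compl false true, fun f => by
  rw [not_bit_compl]
  constructor
  · intro h a
    rw [h a]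
    exact fun h => Bool.false_ne_true (h.1.symm.trans h.2)
  · intro h a
    have h₁ := h a
    have h₂ := h aᶜ
    rw [compl_compl] at h₂
    revert h₁ h₂
    cases f.2 a <;> cases f.2 aᶜ <;> simp⟩

instance : Described Smin := ⟨fun s => !bit s.compl true true, fun f => by
  rw [not_bit_compl]
  constructor
  · rintro ⟨g, hg, hfg⟩ a ⟨h, h'⟩
    have h₁ := hfg a h
    have h₂ := hfg aᶜ h'
    have := hg a
    simp only at this
    rw [h₁, h₂] at this
    exact absurd this (by decide)
  · intro h
    -- where `f` vanishes on both `a` and `aᶜ`, the first coordinate decides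
    refine ⟨fun a => f.2 a || (!f.2 aᶜ && a ⟨0, f.1.pos⟩), fun a => ?_, fun a => ?_⟩
    · have := h a
      simp only [compl_compl, Pi.compl_apply]
      revert this
      cases f.2 a <;> cases f.2 aᶜ <;> cases a ⟨0, f.1.pos⟩ <;> decide
    · exact le_sup_left⟩

instance : Described Smaj := ⟨fun s => !bit s.compl false false, fun f => by
  rw [not_bit_compl]
  constructor
  · rintro ⟨g, hg, hfg⟩ a ⟨h, h'⟩
    have h₁ : g a = false := le_bot_iff.1 ((hfg a).trans h.le)
    have h₂ : g aᶜ = false := le_bot_iff.1 ((hfg aᶜ).trans h'.le)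
    have := hg a
    simp only at this
    rw [h₁, h₂] at this
    exact absurd this (by decide)
  · intro h
    -- where `f` holds on both `a` and `aᶜ`, the first coordinate decides
    refine ⟨fun a => f.2 a && (!f.2 aᶜ || a ⟨0, f.1.pos⟩), fun a => ?_, fun a => ?_⟩
    · have := h a
      simp only [compl_compl, Pi.compl_apply]
      revert this
      cases f.2 a <;> cases f.2 aᶜ <;> cases a ⟨0, f.1.pos⟩ <;> decide
    · exact inf_le_left⟩

instance : Described U := ⟨fun s => !bit s.disj true true, fun f => by
  refine Iff.trans ?_ not_bit_mask.symm
  have h : ∀ x y : Bool, (x, y) ∈ colDisj ↔ x ⊓ y = false := by decide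
  simp only [h, U, Set.mem_ofPred_eq, ne_eq, funext_iff, Pi.inf_apply]
  exact forall₂_congr fun a b => by tauto⟩

instance : Described W := ⟨fun s => !bit s.cov false false, fun f => by
  refine Iff.trans ?_ not_bit_mask.symm
  have h : ∀ x y : Bool, (x, y) ∈ colCov ↔ x ⊔ y = true := by decide
  simp only [h, W, Set.mem_ofPred_eq, ne_eq, funext_iff, Pi.sup_apply]
  exact forall₂_congr fun a b => by tauto⟩

/-- The codes in `stableCodes` in which exactly one pair `(f(0), f(1))` is realized. They include
the codes of all single functions. -/
def principalCodes : List Code := stableCodes.filter fun s => [1, 2, 4, 8].contains s.lt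

theorem code_singleton_mem_principalCodes (f : BoolFun) : code {f} ∈ principalCodes := by
  classical
  refine List.mem_filter.2 ⟨code_mem_stableCodes _, ?_⟩
  have h : (code {f}).lt = maskOf fun x y => atZero f == x && atOne f == y := by
    change mask {f} colLt = _
    refine congrArg maskOf (funext₂ fun x y => ?_)
    rw [Bool.eq_iff_iff, decide_eq_true_iff, realizes_singleton_colLt]
    simp
  rw [h]
  cases atZero f <;> cases atOne f <;> decide

theorem Described.eq_classOf {N : Set BoolFun} [D : Described N] {s : Code}
    (h : (principalCodes.all fun t => D.test t == t.below s) = true) : N = classOf s :=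
  Set.ext fun f => by
    rw [D.mem_iff, beq_iff_eq.1 (List.all_eq_true.1 h _ (code_singleton_mem_principalCodes f))]
    rfl

theorem forall₂_stableCodes_stableClasses :
    List.Forall₂ (fun s N => N = classOf s) stableCodes stableClasses := by
  unfold stableCodes stableClasses
  simp only [List.map_cons, List.map_nil]
  repeat' refine .cons (Described.eq_classOf (by decide +kernel)) ?_
  exact .nil

/-! ### Distinctness -/

/-- The function of arity `p.1` whose value at the point with binary expansion `k` is the `k`-th bit
of `p.2`. -/
def tabulated (p : ℕ+ × ℕ) : BoolFun := ⟨p.1, fun a => p.2.testBit (Nat.ofBits a)⟩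

/-- A computable form of `mask {tabulated p} T`. -/
def tabulatedMask (p : ℕ+ × ℕ) (T : Finset (Bool × Bool)) : ℕ :=
  maskOf fun x y => decide (∃ k < 2 ^ (p.1 : ℕ), p.2.testBit k = x ∧
    ∃ l < 2 ^ (p.1 : ℕ), p.2.testBit l = y ∧ ∀ i < (p.1 : ℕ), (k.testBit i, l.testBit i) ∈ T)

theorem mask_tabulated (p : ℕ+ × ℕ) (T : Finset (Bool × Bool)) :
    mask {tabulated p} T = tabulatedMask p T := by
  classical
  refine congrArg maskOf (funext₂ fun x y => ?_)
  rw [decide_eq_decide, realizes_singleton]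
  constructor
  · rintro ⟨a, b, hab, hx, hy⟩
    refine ⟨Nat.ofBits a, Nat.ofBits_lt_two_pow a, hx, Nat.ofBits b, Nat.ofBits_lt_two_pow b, hy,
      fun i hi => ?_⟩
    rw [Nat.testBit_ofBits_lt a i hi, Nat.testBit_ofBits_lt b i hi]
    exact hab ⟨i, hi⟩
  · rintro ⟨k, hk, hx, l, hl, hy, h⟩
    have key : ∀ m < 2 ^ (p.1 : ℕ), (tabulated p).2 (fun i => m.testBit i) = p.2.testBit m := by
      intro m hm
      exact congrArg p.2.testBit ((Nat.ofBits_testBit m p.1).trans (Nat.mod_eq_of_lt hm))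
    exact ⟨fun i => k.testBit i, fun i => l.testBit i, fun i => h i i.2,
      (key k hk).trans hx, (key l hl).trans hy⟩

/-- A computable form of `code {tabulated p}`. -/
def tabulatedCode (p : ℕ+ × ℕ) : Code :=
  ⟨tabulatedMask p colLt, tabulatedMask p colCompl, tabulatedMask p colBot,
    tabulatedMask p colTop, tabulatedMask p colLe, tabulatedMask p colDisj,
    tabulatedMask p colCov, tabulatedMask p colAll⟩

theorem code_tabulated (p : ℕ+ × ℕ) : code {tabulated p} = tabulatedCode p := by
  simp only [code, tabulatedCode, mask_tabulated]

/-- Functions whose codes generate all stable codes under unions. -/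
def irreducibles : List (ℕ+ × ℕ) :=
  [(1, 0), (1, 1), (1, 2), (1, 3), (2, 1), (2, 2), (2, 6), (2, 7), (2, 8), (2, 9), (2, 11),
    (2, 14), (3, 6), (3, 9), (3, 40), (3, 43), (3, 47), (3, 130), (3, 142), (3, 143), (3, 171),
    (3, 174)]

/-- The codes of the functions in `irreducibles`. -/
def irreducibleCodes : List Code :=
  [0x11111111, 0x46c5de7f, 0x263ab7ef, 0x88888888, 0x47c5df7f, 0x1735f77f, 0x1935ffff, 0x4ec5deff,
    0x273ab7ff, 0x89caffff, 0x8ecafeef, 0x2e3abfef, 0x1735ff7f, 0x47c5ff7f, 0x1735f7ff, 0x46c5ffff,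
    0x4ec5feff, 0x273af7ff, 0x263affff, 0x8ecafeff, 0x8ecaffef, 0x2e3affef].map Code.ofNat

theorem map_tabulatedCode_irreducibles : irreducibles.map tabulatedCode = irreducibleCodes := by
  decide +kernel

/-- The componentwise union of codes. -/
def Code.sup (s t : Code) : Code :=
  ⟨s.lt ||| t.lt, s.compl ||| t.compl, s.bot ||| t.bot, s.top ||| t.top, s.le ||| t.le,
    s.disj ||| t.disj, s.cov ||| t.cov, s.all ||| t.all⟩

theorem sup_irreducibleCodes : ∀ s ∈ stableCodes,
    (irreducibleCodes.filter fun t => t.below s).foldr Code.sup (.ofNat 0) = s := by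
  decide +kernel

/-- Which of the functions in `irreducibles` belong to `classOf s` determines `s`. -/
theorem classOf_injOn : Set.InjOn classOf {s | s ∈ stableCodes} := by
  intro s hs s' hs' h
  rw [← sup_irreducibleCodes s hs, ← sup_irreducibleCodes s' hs']
  congr 1
  refine List.filter_congr fun t ht => ?_
  rw [← map_tabulatedCode_irreducibles] at ht
  obtain ⟨p, -, rfl⟩ := List.mem_map.1 ht
  rw [← code_tabulated, Bool.eq_iff_iff]
  exact Set.ext_iff.1 h (tabulated p)

theorem stableCodes_nodup : stableCodes.Nodup := by decide +kernel

theorem stableClasses_eq_map : stableClasses = stableCodes.map classOf := by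
  rw [← List.forall₂_eq_eq_eq, List.forall₂_map_right_iff]
  exact forall₂_stableCodes_stableClasses.flip

theorem isStable_iff_mem_stableClasses {K : Set BoolFun} :
    IsStable Proj SM K ↔ K ∈ stableClasses := by
  rw [stableClasses_eq_map, List.mem_map]
  constructor
  · intro h
    exact ⟨code K, code_mem_stableCodes K,
      (eq_classOf_code h.isMinorClosed h.comp_maj_subset).symm⟩
  · rintro ⟨s, -, rfl⟩
    exact isStable_classOf s

theorem ncard_isStable : {K : Set BoolFun | IsStable Proj SM K}.ncard = 93 := by
  have h : {K : Set BoolFun | IsStable Proj SM K} = classOf '' (stableCodes.toFinset : Set Code) := by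
    ext K
    rw [Set.mem_ofPred_eq, isStable_iff_mem_stableClasses, stableClasses_eq_map, List.mem_map,
      List.coe_toFinset]
    rfl
  rw [h, Set.InjOn.ncard_image (by rw [List.coe_toFinset]; exact classOf_injOn),
    Set.ncard_coe_finset, List.toFinset_card_of_nodup stableCodes_nodup]
  rfl

end BoolMinion

open BoolMinion in
theorem theorem4p1 :
    {K : Set BoolFun | IsStable Proj SM K}.ncard = 93 ∧
    (∀ K : Set BoolFun, IsStable Proj SM K ↔ K ∈ stableClasses) ∧
    (∀ K : Set BoolFun, IsStable Proj SM K ↔ IsMinorClosed K ∧ comp {maj} K ⊆ K) :=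
  ⟨ncard_isStable, fun _ => isStable_iff_mem_stableClasses, fun _ => isStable_iff⟩
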